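/- Let $X$ and $Y$ be independent real random variables with finite variances $\sigma_X^2=\mathrm{Var}[X]$, $\sigma_Y^2=\mathrm{Var}[Y]$ and means $\mu_X=\mathbb{E}[X]$, $\mu_Y=\mathbb{E}[Y]\neq 0$. Let $(X_1,Y_1),(X_2,Y_2),\dots$ be independent random vectors, each with the law of $(X,Y)$. For $N\ge 1$ let $$\overline{X}_N=\frac1N\sum_{i=1}^N X_i,\qquad \overline{\sigma}^2_{X,N}=\frac1N\sum_{i=1}^N (X_i-\overline{X}_N)^2,$$ define $\overline{Y}_N$ and $\overline{\sigma}^2_{Y,N}$ in the same way, and put $$\hat\sigma_{\rm ratio}=\sqrt{\frac{\overline{\sigma}^2_{X,N}}{(\overline{Y}_N)^2}+\frac{(\overline{X}_N\,\overline{\sigma}_{Y,N})^2}{(\overline{Y}_N)^4}},\qquad \sigma^2_{\rm ratio}=\frac{\sigma_X^2}{\mu_Y^2}+\frac{\mu_X^2}{\mu_Y^4}\sigma_Y^2 .$$ (Where a denominator vanishes the quotient is given the value $0$.) Then $\hat\sigma_{\rm ratio}^2\to\sigma_{\rm ratio}^2$ in probability as $N\to\infty$. If moreover $\sigma_{\rm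 ratio}^2\neq 0$, then $$\frac{\sqrt N}{\hat\sigma_{\rm ratio}}\left(\frac{\overline{X}_N}{\overline{Y}_N}-\frac{\mu_X}{\mu_Y}\right)\to\mathcal N(0,1)\quad\text{in distribution as } N\to\infty,$$ and for every $\delta\in(0,1)$ there is $z_{\delta/2}>0$ with $\frac{1}{\sqrt{2\pi}}\int_{z_{\delta/2}}^\infty e^{-t^2/2}\,dt=\delta/2$ and $z_{\delta/2}^2\le 2\ln(1/\delta)$ such that $$\Pr\left(\left|\frac{\overline{X}_N}{\overline{Y}_N}-\frac{\mu_X}{\mu_Y}\right|\le\sqrt{\frac{\hat\sigma_{\rm ratio}^2\,z_{\delta/2}^2}{N}}\right)\to 1-\delta\quad\text{as } N\to\infty .$$ -/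

import Mathlib

open MeasureTheory ProbabilityTheory Filter Topology

noncomputable section

/-- Sample mean of the first `N` samples. -/
def sampleMean {Ω : Type*} (X : ℕ → Ω → ℝ) (N : ℕ) (ω : Ω) : ℝ :=
  (∑ i ∈ Finset.range N, X i ω) / N

/-- Sample variance of the first `N` samples, with normalization `1 / N`. -/
def sampleVariance {Ω : Type*} (X : ℕ → Ω → ℝ) (N : ℕ) (ω : Ω) : ℝ :=
  (∑ i ∈ Finset.range N, (X i ω - sampleMean X N ω) ^ 2) / N

/-- The estimator of the asymptotic standard deviation of the ratio of sample means. -/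
def ratioSigmaHat {Ω : Type*} (X Y : ℕ → Ω → ℝ) (N : ℕ) (ω : Ω) : ℝ :=
  √(sampleVariance X N ω / (sampleMean Y N ω) ^ 2
    + (sampleMean X N ω * √(sampleVariance Y N ω)) ^ 2 / (sampleMean Y N ω) ^ 4)

/-- The asymptotic variance of the ratio of sample means. -/
def ratioVariance {Ω : Type*} [MeasurableSpace Ω] (X Y : Ω → ℝ) (μ : Measure Ω) : ℝ :=
  Var[X; μ] / (∫ ω, Y ω ∂μ) ^ 2 + (∫ ω, X ω ∂μ) ^ 2 / (∫ ω, Y ω ∂μ) ^ 4 * Var[Y; μ]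

end

/-!
Write `a`, `b` for the means of `X`, `Y`. The ratio of sample means is linearized: where the sample
mean of `Y` is nonzero, the error `mean X / mean Y - a / b` equals
`(b * mean X - a * mean Y) / (b * mean Y)`, so the studentized ratio is the normalized sum of the
i.i.d. centred variables `b * X i - a * Y i`, times `1 / (b * mean Y * ratioSigmaHat)`
(`studentized_ratio_eq`). By independence of `X` and `Y` those variables have variance
`b ^ 4 * ratioVariance` (`variance_linearization`).

The sample variance is the sample mean of the squares minus the square of the sample mean, so the
strong law of large numbers gives almost sure convergence of all estimators, hence consistency of
`ratioSigmaHat ^ 2`. The central limit theorem applies to the normalized sum, the random factor tends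
to `1 / (b ^ 2 * √ratioVariance)`, and Slutsky's theorem yields the standard normal limit
(`tendstoInDistribution_studentized_ratio`).

The coverage probability follows from the portmanteau theorem for the interval `[-z, z]`, because the
confidence event is `|T| ≤ z` for the studentized ratio `T` unless `ratioSigmaHat` vanishes
(`tendsto_confidence_probability`). The quantile `z` exists by the intermediate value theorem, and
`z ^ 2 ≤ 2 * log (1 / δ)` comes from the tail bound
`∫ t in Ioi z, exp (-t ^ 2 / 2) ≤ exp (-z ^ 2 / 2) * ∫ t in Ioi 0, exp (-t ^ 2 / 2)`, whose constant
`√(2 * π) / 2` is what makes the bound `log (1 / δ)` rather than `log (2 / δ)`.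
-/

/-! ### Tails of the standard normal distribution -/

lemma integrable_exp_neg_sq_div_two : Integrable fun t : ℝ => Real.exp (-t ^ 2 / 2) := by
  refine (integrable_exp_neg_mul_sq (b := 1 / 2) (by norm_num)).congr (ae_of_all _ fun t => ?_)
  simp only
  ring_nf

lemma setIntegral_Ioi_zero_exp_neg_sq_div_two :
    ∫ t in Set.Ioi (0 : ℝ), Real.exp (-t ^ 2 / 2) = √(2 * Real.pi) / 2 := by
  have h := integral_gaussian_Ioi (1 / 2)
  calc _ = ∫ t in Set.Ioi (0 : ℝ), Real.exp (-(1 / 2) * t ^ 2) := by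
        congr 1 with t
        ring_nf
    _ = _ := by rw [h]; congr 2; ring

lemma setIntegral_Ioi_exp_neg_sq_div_two_le {z : ℝ} (hz : 0 ≤ z) :
    ∫ t in Set.Ioi z, Real.exp (-t ^ 2 / 2) ≤ Real.exp (-z ^ 2 / 2) * (√(2 * Real.pi) / 2) := by
  -- Translate the domain to `(0, ∞)`; there `(t + z) ^ 2 ≥ t ^ 2 + z ^ 2`.
  rw [← setIntegral_Ioi_zero_exp_neg_sq_div_two, ← integral_const_mul,
    ← integral_indicator measurableSet_Ioi, ← integral_indicator measurableSet_Ioi,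
    ← integral_add_right_eq_self _ z]
  refine integral_mono
    ((integrable_exp_neg_sq_div_two.indicator measurableSet_Ioi).comp_add_right z)
    ((integrable_exp_neg_sq_div_two.const_mul _).indicator measurableSet_Ioi) fun t => ?_
  by_cases ht : 0 < t
  · simp only [Set.indicator, Set.mem_Ioi, lt_add_iff_pos_left, ht, if_true, ← Real.exp_add]
    gcongr
    nlinarith
  · simp [Set.indicator, ht]

lemma exists_setIntegral_Ioi_exp_neg_sq_div_two_eq {δ : ℝ} (h0 : 0 < δ) (h1 : δ < 1) :
    ∃ z : ℝ, 0 < z ∧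
      1 / √(2 * Real.pi) * (∫ t in Set.Ioi z, Real.exp (-t ^ 2 / 2)) = δ / 2 := by
  have hs : 0 < √(2 * Real.pi) := by positivity
  have hcont : ContinuousOn (fun z : ℝ => ∫ t in Set.Ioi z, Real.exp (-t ^ 2 / 2))
      (Set.Ici 0) :=
    integrable_exp_neg_sq_div_two.integrableOn.continuousOn_Ici_primitive_Ioi
  have hlim : Tendsto (fun z : ℝ => ∫ t in Set.Ioi z, Real.exp (-t ^ 2 / 2)) atTop (𝓝 0) :=
    tendsto_integral_Ioi_zero tendsto_id
  have hδ : 0 < √(2 * Real.pi) * (δ / 2) := by positivity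
  obtain ⟨b, hbδ, hb⟩ := ((hlim.eventually_lt_const hδ).and (eventually_ge_atTop 0)).exists
  have hmem : √(2 * Real.pi) * (δ / 2) ∈ Set.Icc (∫ t in Set.Ioi b, Real.exp (-t ^ 2 / 2))
      (∫ t in Set.Ioi (0 : ℝ), Real.exp (-t ^ 2 / 2)) := by
    refine ⟨hbδ.le, ?_⟩
    rw [setIntegral_Ioi_zero_exp_neg_sq_div_two]
    nlinarith
  obtain ⟨z, hz, hzδ⟩ := intermediate_value_Icc' hb (hcont.mono Set.Icc_subset_Ici_self) hmem
  simp only at hzδ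
  refine ⟨z, hz.1.lt_of_ne ?_, ?_⟩
  · rintro rfl
    rw [setIntegral_Ioi_zero_exp_neg_sq_div_two] at hzδ
    nlinarith
  · rw [hzδ]
    field_simp

lemma sq_le_two_mul_log_of_setIntegral_Ioi_eq {z δ : ℝ} (hδ : 0 < δ) (hz : 0 ≤ z)
    (h : 1 / √(2 * Real.pi) * (∫ t in Set.Ioi z, Real.exp (-t ^ 2 / 2)) = δ / 2) :
    z ^ 2 ≤ 2 * Real.log (1 / δ) := by
  have hs : 0 < √(2 * Real.pi) := by positivity
  have hle := setIntegral_Ioi_exp_neg_sq_div_two_le hz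
  have hδle : δ ≤ Real.exp (-z ^ 2 / 2) := by
    rw [one_div, inv_mul_eq_div, div_eq_iff hs.ne'] at h
    rw [h] at hle
    nlinarith
  have := Real.log_le_log hδ hδle
  rw [Real.log_exp] at this
  rw [one_div, Real.log_inv]
  linarith

lemma gaussianReal_zero_one_real_Ioi (z : ℝ) :
    (gaussianReal 0 1).real (Set.Ioi z)
      = 1 / √(2 * Real.pi) * ∫ t in Set.Ioi z, Real.exp (-t ^ 2 / 2) := by
  rw [Measure.real, gaussianReal_apply_eq_integral _ one_ne_zero, ENNReal.toReal_ofReal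
    (integral_nonneg fun t => gaussianPDFReal_nonneg _ _ _), ← integral_const_mul]
  simp [gaussianPDFReal]

lemma gaussianReal_zero_one_real_Icc {z : ℝ} (hz : 0 ≤ z) :
    (gaussianReal 0 1).real (Set.Icc (-z) z)
      = 1 - 2 * (1 / √(2 * Real.pi) * ∫ t in Set.Ioi z, Real.exp (-t ^ 2 / 2)) := by
  have hneg : (gaussianReal 0 1).real (Set.Iio (-z)) = (gaussianReal 0 1).real (Set.Ioi z) := by
    have h : (gaussianReal 0 1).map (fun x => -x) = gaussianReal 0 1 := by
      simpa using gaussianReal_map_neg (μ := 0) (v := 1)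
    conv_lhs => rw [← h, map_measureReal_apply measurable_neg measurableSet_Iio]
    congr 1
    ext x
    simp
  have hcompl : (Set.Icc (-z) z)ᶜ = Set.Iio (-z) ∪ Set.Ioi z := by
    ext x
    simp only [Set.mem_compl_iff, Set.mem_Icc, not_and_or, not_le, Set.mem_union, Set.mem_Iio,
      Set.mem_Ioi]
  have hdisj : Disjoint (Set.Iio (-z)) (Set.Ioi z) :=
    Set.disjoint_left.2 fun x (hx : x < -z) (hx' : z < x) => by linarith
  have h := probReal_compl_eq_one_sub (μ := gaussianReal 0 1)
    (measurableSet_Icc (a := -z) (b := z))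
  rw [hcompl, measureReal_union hdisj measurableSet_Ioi, hneg, gaussianReal_zero_one_real_Ioi] at h
  linarith

/-! ### Algebraic identities for the estimators -/

section Algebra

variable {Ω : Type*}

lemma sampleVariance_nonneg (Xs : ℕ → Ω → ℝ) (N : ℕ) (ω : Ω) : 0 ≤ sampleVariance Xs N ω := by
  unfold sampleVariance
  positivity

/-- This holds for `N = 0` too, where every quotient by `N` is `0`. -/
lemma sampleVariance_eq_sub (Xs : ℕ → Ω → ℝ) (N : ℕ) (ω : Ω) :
    sampleVariance Xs N ω
      = sampleMean (fun i ω => Xs i ω ^ 2) N ω - sampleMean Xs N ω ^ 2 := by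
  rcases eq_or_ne N 0 with rfl | hN
  · simp [sampleVariance, sampleMean]
  have hsum : ∑ i ∈ Finset.range N, Xs i ω = N * sampleMean Xs N ω := by
    unfold sampleMean
    field_simp
  unfold sampleVariance
  simp_rw [sub_sq, Finset.sum_add_distrib, Finset.sum_sub_distrib, ← Finset.sum_mul,
    ← Finset.mul_sum, hsum]
  simp only [sampleMean, Finset.sum_const, Finset.card_range, nsmul_eq_mul]
  field_simp
  ring

lemma ratioSigmaHat_sq (Xs Ys : ℕ → Ω → ℝ) (N : ℕ) (ω : Ω) :
    ratioSigmaHat Xs Ys N ω ^ 2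
      = sampleVariance Xs N ω / sampleMean Ys N ω ^ 2
        + sampleMean Xs N ω ^ 2 / sampleMean Ys N ω ^ 4 * sampleVariance Ys N ω := by
  have := sampleVariance_nonneg Xs N ω
  have := sampleVariance_nonneg Ys N ω
  unfold ratioSigmaHat
  rw [Real.sq_sqrt (by positivity), mul_pow, Real.sq_sqrt ‹_›]
  ring

/-- The studentized ratio is exactly, not just asymptotically, a random factor times the normalized
sum of the linearized variables. When the sample mean of `Y` vanishes both sides are `0`, since then
`ratioSigmaHat` is `0` as well. -/
lemma studentized_ratio_eq (Xs Ys : ℕ → Ω → ℝ) (a : ℝ) {b : ℝ} (hb : b ≠ 0) (N : ℕ) (ω : Ω) :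
    √(N : ℝ) / ratioSigmaHat Xs Ys N ω * (sampleMean Xs N ω / sampleMean Ys N ω - a / b)
      = (√(N : ℝ))⁻¹ * (∑ i ∈ Finset.range N, (b * Xs i ω + -a * Ys i ω))
        * (b * (sampleMean Ys N ω * ratioSigmaHat Xs Ys N ω))⁻¹ := by
  rcases eq_or_ne N 0 with rfl | hN
  · simp
  rcases eq_or_ne (sampleMean Ys N ω) 0 with hY | hY
  · simp [ratioSigmaHat, hY]
  rcases eq_or_ne (ratioSigmaHat Xs Ys N ω) 0 with hσ | hσ
  · simp [hσ]
  have hN' : (0 : ℝ) < N := by positivity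
  have hsum : ∑ i ∈ Finset.range N, (b * Xs i ω + -a * Ys i ω)
      = √(N : ℝ) ^ 2 * (b * sampleMean Xs N ω - a * sampleMean Ys N ω) := by
    rw [Finset.sum_add_distrib, ← Finset.mul_sum, ← Finset.mul_sum, Real.sq_sqrt hN'.le]
    unfold sampleMean
    field_simp
    ring
  have : √(N : ℝ) ≠ 0 := by positivity
  rw [hsum]
  field_simp

end Algebra

/-! ### Laws of large numbers for sample means and variances -/

section LawOfLargeNumbers

variable {Ω₀ : Type*} [MeasurableSpace Ω₀] {μ : Measure Ω₀}
  {Ω : Type*} [MeasurableSpace Ω] {P : Measure Ω} {X : Ω₀ → ℝ} {Xs : ℕ → Ω → ℝ}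

lemma aemeasurable_sampleMean (hXs : ∀ i, AEMeasurable (Xs i) P) (N : ℕ) :
    AEMeasurable (sampleMean Xs N) P :=
  (Finset.aemeasurable_fun_sum _ fun i _ => hXs i).div_const _

lemma aemeasurable_sampleVariance (hXs : ∀ i, AEMeasurable (Xs i) P) (N : ℕ) :
    AEMeasurable (sampleVariance Xs N) P :=
  (Finset.aemeasurable_fun_sum _ fun i _ =>
    ((hXs i).sub (aemeasurable_sampleMean hXs N)).pow_const 2).div_const _

lemma aemeasurable_ratioSigmaHat {Ys : ℕ → Ω → ℝ} (hXs : ∀ i, AEMeasurable (Xs i) P)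
    (hYs : ∀ i, AEMeasurable (Ys i) P) (N : ℕ) : AEMeasurable (ratioSigmaHat Xs Ys N) P := by
  have := aemeasurable_sampleMean hXs N
  have := aemeasurable_sampleMean hYs N
  have := aemeasurable_sampleVariance hXs N
  have := aemeasurable_sampleVariance hYs N
  unfold ratioSigmaHat
  fun_prop

lemma tendsto_sampleMean_ae (hX : Integrable X μ) (hindep : iIndepFun Xs P)
    (hident : ∀ i, IdentDistrib (Xs i) X P μ) :
    ∀ᵐ ω ∂P, Tendsto (fun N => sampleMean Xs N ω) atTop (𝓝 (∫ ω, X ω ∂μ)) := by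
  rw [← (hident 0).integral_eq]
  exact strong_law_ae_real Xs ((hident 0).integrable_iff.2 hX)
    (fun i j hij => hindep.indepFun hij) fun i => (hident i).trans (hident 0).symm

lemma tendsto_sampleVariance_ae [IsProbabilityMeasure μ] (hX : MemLp X 2 μ)
    (hindep : iIndepFun Xs P) (hident : ∀ i, IdentDistrib (Xs i) X P μ) :
    ∀ᵐ ω ∂P, Tendsto (fun N => sampleVariance Xs N ω) atTop (𝓝 Var[X; μ]) := by
  filter_upwards [tendsto_sampleMean_ae (hX.integrable one_le_two) hindep hident,
    tendsto_sampleMean_ae hX.integrable_sq (hindep.comp (fun _ x => x ^ 2) fun _ => by fun_prop)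
      fun i => (hident i).sq] with ω h1 h2
  simp_rw [sampleVariance_eq_sub]
  rw [variance_eq_sub hX]
  exact h2.sub (h1.pow 2)

end LawOfLargeNumbers

lemma ratioVariance_nonneg {Ω : Type*} [MeasurableSpace Ω] (X Y : Ω → ℝ) (μ : Measure Ω) :
    0 ≤ ratioVariance X Y μ := by
  have := variance_nonneg X μ
  have := variance_nonneg Y μ
  unfold ratioVariance
  positivity

/-- The delta-method variance: `b * X - a * Y`, with `a`, `b` the means of `X`, `Y`, is the gradient of
the ratio at `(a, b)` scaled by `b ^ 2`, which accounts for the factor `b ^ 4`. -/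
lemma variance_linearization {Ω : Type*} [MeasurableSpace Ω] {μ : Measure Ω} {X Y : Ω → ℝ}
    (hXY : IndepFun X Y μ) (hX : MemLp X 2 μ) (hY : MemLp Y 2 μ) (hμY : (∫ ω, Y ω ∂μ) ≠ 0) :
    Var[fun ω => (∫ ω, Y ω ∂μ) * X ω + -(∫ ω, X ω ∂μ) * Y ω; μ]
      = (∫ ω, Y ω ∂μ) ^ 4 * ratioVariance X Y μ := by
  rw [IndepFun.variance_fun_add (hX.const_mul _) (hY.const_mul _)
    (hXY.comp (measurable_const_mul _) (measurable_const_mul _)), variance_const_mul,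
    variance_const_mul, ratioVariance]
  field_simp

/-! ### Asymptotics of the ratio of sample means -/

section Ratio

variable {Ω₀ : Type*} [MeasurableSpace Ω₀] {μ : Measure Ω₀} [IsProbabilityMeasure μ]
  {Ω : Type*} [MeasurableSpace Ω] {P : Measure Ω}
  {X Y : Ω₀ → ℝ} {Xs Ys : ℕ → Ω → ℝ}

lemma tendsto_ratioSigmaHat_sq_ae (hX : MemLp X 2 μ) (hY : MemLp Y 2 μ)
    (hμY : (∫ ω, Y ω ∂μ) ≠ 0) (hXs : iIndepFun Xs P) (hYs : iIndepFun Ys P)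
    (hidX : ∀ i, IdentDistrib (Xs i) X P μ) (hidY : ∀ i, IdentDistrib (Ys i) Y P μ) :
    ∀ᵐ ω ∂P, Tendsto (fun N => ratioSigmaHat Xs Ys N ω ^ 2) atTop (𝓝 (ratioVariance X Y μ)) := by
  filter_upwards [tendsto_sampleMean_ae (hX.integrable one_le_two) hXs hidX,
    tendsto_sampleMean_ae (hY.integrable one_le_two) hYs hidY,
    tendsto_sampleVariance_ae hX hXs hidX, tendsto_sampleVariance_ae hY hYs hidY]
    with ω hmX hmY hvX hvY
  simp_rw [ratioSigmaHat_sq]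
  exact (hvX.div (hmY.pow 2) (pow_ne_zero 2 hμY)).add
    (((hmX.pow 2).div (hmY.pow 4) (pow_ne_zero 4 hμY)).mul hvY)

variable [IsProbabilityMeasure P]

/-- Central limit theorem for the linearized variables, with the limit realized as a multiple of a
standard normal variable; it is degenerate when `ratioVariance X Y μ = 0`. -/
lemma tendstoInDistribution_sum_linearization (hXY : IndepFun X Y μ)
    (hX : MemLp X 2 μ) (hY : MemLp Y 2 μ) (hμY : (∫ ω, Y ω ∂μ) ≠ 0)
    (hindep : iIndepFun (fun (i : ℕ) (ω : Ω) => (Xs i ω, Ys i ω)) P)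
    (hident : ∀ i : ℕ,
      IdentDistrib (fun ω : Ω => (Xs i ω, Ys i ω)) (fun ω : Ω₀ => (X ω, Y ω)) P μ) :
    TendstoInDistribution
      (fun (N : ℕ) ω => (√(N : ℝ))⁻¹ * ∑ i ∈ Finset.range N,
        ((∫ ω, Y ω ∂μ) * Xs i ω + -(∫ ω, X ω ∂μ) * Ys i ω))
      atTop (fun x => (∫ ω, Y ω ∂μ) ^ 2 * √(ratioVariance X Y μ) * x) (fun _ => P)
      (gaussianReal 0 1) := by
  set a := ∫ ω, X ω ∂μ with ha
  set b := ∫ ω, Y ω ∂μ with hb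
  let f : ℝ × ℝ → ℝ := fun p => b * p.1 + -a * p.2
  have hf : Measurable f := by fun_prop
  let W : ℕ → Ω → ℝ := fun i ω => b * Xs i ω + -a * Ys i ω
  have hWid (i : ℕ) : IdentDistrib (W i) (fun ω => b * X ω + -a * Y ω) P μ := (hident i).comp hf
  have hmean : P[W 0] = 0 := by
    rw [(hWid 0).integral_eq, integral_add ((hX.integrable one_le_two).const_mul _)
      ((hY.integrable one_le_two).const_mul _), integral_const_mul, integral_const_mul, ← ha, ← hb]
    ring
  have hvar : Var[W 0; P] = b ^ 4 * ratioVariance X Y μ := by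
    rw [(hWid 0).variance_eq, variance_linearization hXY hX hY hμY]
  have hlaw : HasLaw (fun x => b ^ 2 * √(ratioVariance X Y μ) * x)
      (gaussianReal 0 Var[W 0; P].toNNReal) (gaussianReal 0 1) := by
    convert! gaussianReal_const_mul (HasLaw.id (μ := gaussianReal 0 1))
      (b ^ 2 * √(ratioVariance X Y μ)) using 2
    · simp
    · ext
      rw [Real.coe_toNNReal _ (variance_nonneg _ _), hvar]
      simp [mul_pow, Real.sq_sqrt (ratioVariance_nonneg X Y μ), ← pow_mul]
  have h := tendstoInDistribution_inv_sqrt_mul_sum_sub hlaw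
    ((hWid 0).memLp_iff.2 ((hX.const_mul b).add (hY.const_mul (-a))))
    (hindep.comp (fun _ => f) fun _ => hf) fun i => (hWid i).trans (hWid 0).symm
  simpa only [hmean, mul_zero, sub_zero] using h

lemma tendstoInDistribution_studentized_ratio (hXY : IndepFun X Y μ)
    (hX : MemLp X 2 μ) (hY : MemLp Y 2 μ) (hμY : (∫ ω, Y ω ∂μ) ≠ 0)
    (hindep : iIndepFun (fun (i : ℕ) (ω : Ω) => (Xs i ω, Ys i ω)) P)
    (hident : ∀ i : ℕ,
      IdentDistrib (fun ω : Ω => (Xs i ω, Ys i ω)) (fun ω : Ω₀ => (X ω, Y ω)) P μ)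
    (hσ : ratioVariance X Y μ ≠ 0) :
    TendstoInDistribution
      (fun (N : ℕ) (ω : Ω) => √(N : ℝ) / ratioSigmaHat Xs Ys N ω *
        (sampleMean Xs N ω / sampleMean Ys N ω - (∫ ω, X ω ∂μ) / (∫ ω, Y ω ∂μ)))
      atTop (id : ℝ → ℝ) (fun _ => P) (gaussianReal 0 1) := by
  have hXs : iIndepFun Xs P := hindep.comp (fun _ => Prod.fst) fun _ => measurable_fst
  have hYs : iIndepFun Ys P := hindep.comp (fun _ => Prod.snd) fun _ => measurable_snd
  have hidX (i : ℕ) : IdentDistrib (Xs i) X P μ := (hident i).comp measurable_fst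
  have hidY (i : ℕ) : IdentDistrib (Ys i) Y P μ := (hident i).comp measurable_snd
  have hσpos : 0 < √(ratioVariance X Y μ) :=
    Real.sqrt_pos.2 ((ratioVariance_nonneg X Y μ).lt_of_ne' hσ)
  set b := ∫ ω, Y ω ∂μ with hb
  have hmeas (N : ℕ) :
      AEMeasurable (fun ω => (b * (sampleMean Ys N ω * ratioSigmaHat Xs Ys N ω))⁻¹) P :=
    (((aemeasurable_sampleMean (fun i => (hidY i).aemeasurable_fst) N).mul
      (aemeasurable_ratioSigmaHat (fun i => (hidX i).aemeasurable_fst)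
        (fun i => (hidY i).aemeasurable_fst) N)).const_mul b).inv
  have hfactor : TendstoInMeasure P
      (fun N ω => (b * (sampleMean Ys N ω * ratioSigmaHat Xs Ys N ω))⁻¹) atTop
      (fun _ => (b * (b * √(ratioVariance X Y μ)))⁻¹) := by
    refine tendstoInMeasure_of_tendsto_ae (fun N => (hmeas N).aestronglyMeasurable) ?_
    filter_upwards [tendsto_ratioSigmaHat_sq_ae hX hY hμY hXs hYs hidX hidY,
      tendsto_sampleMean_ae (hY.integrable one_le_two) hYs hidY] with ω hs hm
    have hs' : Tendsto (fun N => ratioSigmaHat Xs Ys N ω) atTop (𝓝 √(ratioVariance X Y μ)) :=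
      hs.sqrt.congr fun N => Real.sqrt_sq (Real.sqrt_nonneg _)
    exact ((hm.mul hs').const_mul b).inv₀ (by positivity)
  have h := (tendstoInDistribution_sum_linearization hXY hX hY hμY hindep hident)
    |>.continuous_comp_prodMk_of_tendstoInMeasure_const (g := fun p : ℝ × ℝ => p.1 * p.2)
      continuous_mul hfactor hmeas
  refine h.congr (fun N => ae_of_all _ fun ω => ?_) (ae_of_all _ fun x => ?_)
  · exact (studentized_ratio_eq _ _ _ hμY N ω).symm
  · simp only [id]
    rw [← hb]
    field_simp

/-- The confidence event and the event that the studentized ratio lies in `[-z, z]` differ only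
where the estimated standard deviation vanishes, an event of vanishing probability. -/
lemma tendsto_confidence_probability {T R S : ℕ → Ω → ℝ} {s z : ℝ} (hs : s ≠ 0) (hz : 0 < z)
    (hS0 : ∀ N ω, 0 ≤ S N ω) (hS : TendstoInMeasure P (fun N ω => S N ω ^ 2) atTop fun _ => s)
    (hT : ∀ N ω, T N ω = √(N : ℝ) / S N ω * R N ω)
    (hlim : TendstoInDistribution T atTop (id : ℝ → ℝ) (fun _ => P) (gaussianReal 0 1)) :
    Tendsto (fun N : ℕ => P.real {ω | |R N ω| ≤ √(S N ω ^ 2 * z ^ 2 / N)}) atTop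
      (𝓝 ((gaussianReal 0 1).real (Set.Icc (-z) z))) := by
  have hnull : Tendsto (fun N => P.real {ω | S N ω = 0}) atTop (𝓝 0) := by
    rw [tendstoInMeasure_iff_measureReal_norm] at hS
    refine squeeze_zero (fun N => measureReal_nonneg) (fun N => measureReal_mono ?_)
      (hS |s| (abs_pos.2 hs))
    intro ω (hω : S N ω = 0)
    simp [hω]
  have hport : Tendsto (fun N => P.real (T N ⁻¹' Set.Icc (-z) z)) atTop
      (𝓝 ((gaussianReal 0 1).real (Set.Icc (-z) z))) := by
    have := nullSingletonClass_gaussianReal (μ := 0) (v := 1) one_ne_zero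
    have h := ProbabilityMeasure.tendsto_measure_of_null_frontier_of_tendsto' hlim.tendsto
      (E := Set.Icc (-z) z) (by
        simp only [ProbabilityMeasure.coe_mk, Measure.map_id]
        rw [frontier_Icc (by linarith)]
        exact (Set.toFinite _).measure_zero _)
    simp only [ProbabilityMeasure.coe_mk, Measure.map_id] at h
    refine ((ENNReal.tendsto_toReal (measure_ne_top _ _)).comp h).congr fun N => ?_
    simp only [Function.comp, Measure.real]
    rw [Measure.map_apply_of_aemeasurable (hlim.forall_aemeasurable N) measurableSet_Icc]
  have hiff (N : ℕ) (hN : 0 < N) (ω : Ω) (hω : S N ω ≠ 0) :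
      |R N ω| ≤ √(S N ω ^ 2 * z ^ 2 / N) ↔ T N ω ∈ Set.Icc (-z) z := by
    have hSpos : 0 < S N ω := (hS0 N ω).lt_of_ne' hω
    have hN' : 0 < √(N : ℝ) := by positivity
    rw [← mul_pow, Real.sqrt_div (by positivity), Real.sqrt_sq (by positivity), Set.mem_Icc,
      ← abs_le, hT, abs_mul, abs_of_pos (by positivity : 0 < √(N : ℝ) / S N ω), le_div_iff₀ hN',
      div_mul_eq_mul_div, div_le_iff₀ hSpos, mul_comm |R N ω|, mul_comm z]
  have hdiff : Tendsto (fun N : ℕ => P.real {ω | |R N ω| ≤ √(S N ω ^ 2 * z ^ 2 / N)}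
      - P.real (T N ⁻¹' Set.Icc (-z) z)) atTop (𝓝 0) := by
    refine squeeze_zero_norm' ?_ hnull
    filter_upwards [eventually_gt_atTop 0] with N hN
    rw [Real.norm_eq_abs, abs_le]
    constructor
    · have : T N ⁻¹' Set.Icc (-z) z
          ⊆ {ω | |R N ω| ≤ √(S N ω ^ 2 * z ^ 2 / N)} ∪ {ω | S N ω = 0} := fun ω hω =>
        or_iff_not_imp_right.2 fun h => (hiff N hN ω h).2 hω
      linarith [(measureReal_mono (μ := P) this).trans (measureReal_union_le _ _)]
    · have : {ω | |R N ω| ≤ √(S N ω ^ 2 * z ^ 2 / N)}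
          ⊆ T N ⁻¹' Set.Icc (-z) z ∪ {ω | S N ω = 0} := fun ω hω =>
        or_iff_not_imp_right.2 fun h => (hiff N hN ω h).1 hω
      linarith [(measureReal_mono (μ := P) this).trans (measureReal_union_le _ _)]
  simpa using hdiff.add hport

end Ratio

theorem lemma5
    -- the population pair `(X, Y)`
    {Ω₀ : Type*} [MeasurableSpace Ω₀] (μ : Measure Ω₀) [IsProbabilityMeasure μ]
    (X Y : Ω₀ → ℝ) (hXY : IndepFun X Y μ)
    (hX : MemLp X 2 μ) (hY : MemLp Y 2 μ) (hμY : (∫ ω, Y ω ∂μ) ≠ 0)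
    -- independent samples `(Xs i, Ys i)` of `(X, Y)`
    {Ω : Type*} [MeasurableSpace Ω] (P : Measure Ω) [IsProbabilityMeasure P]
    (Xs Ys : ℕ → Ω → ℝ)
    (hindep : iIndepFun (fun (i : ℕ) (ω : Ω) => (Xs i ω, Ys i ω)) P)
    (hident : ∀ i : ℕ,
      IdentDistrib (fun ω : Ω => (Xs i ω, Ys i ω)) (fun ω : Ω₀ => (X ω, Y ω)) P μ) :
    TendstoInMeasure P (fun (N : ℕ) (ω : Ω) => (ratioSigmaHat Xs Ys N ω) ^ 2) atTop
      (fun _ => ratioVariance X Y μ) ∧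
    (ratioVariance X Y μ ≠ 0 →
      TendstoInDistribution
        (fun (N : ℕ) (ω : Ω) => √(N : ℝ) / ratioSigmaHat Xs Ys N ω *
          (sampleMean Xs N ω / sampleMean Ys N ω - (∫ ω, X ω ∂μ) / (∫ ω, Y ω ∂μ)))
        atTop (id : ℝ → ℝ) (fun _ => P) (gaussianReal 0 1) ∧
      ∀ δ : ℝ, 0 < δ → δ < 1 →
        ∃ z : ℝ, 0 < z ∧
          1 / √(2 * Real.pi) * (∫ t in Set.Ioi z, Real.exp (-t ^ 2 / 2)) = δ / 2 ∧
          z ^ 2 ≤ 2 * Real.log (1 / δ) ∧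
          Tendsto
            (fun N : ℕ => P.real {ω : Ω |
              |sampleMean Xs N ω / sampleMean Ys N ω - (∫ ω, X ω ∂μ) / (∫ ω, Y ω ∂μ)|
                ≤ √((ratioSigmaHat Xs Ys N ω) ^ 2 * z ^ 2 / N)})
            atTop (𝓝 (1 - δ))) := by

  have hXs : iIndepFun Xs P := hindep.comp (fun _ => Prod.fst) fun _ => measurable_fst
  have hYs : iIndepFun Ys P := hindep.comp (fun _ => Prod.snd) fun _ => measurable_snd
  have hidX (i : ℕ) : IdentDistrib (Xs i) X P μ := (hident i).comp measurable_fst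
  have hidY (i : ℕ) : IdentDistrib (Ys i) Y P μ := (hident i).comp measurable_snd
  have hcons : TendstoInMeasure P (fun (N : ℕ) (ω : Ω) => (ratioSigmaHat Xs Ys N ω) ^ 2) atTop
      (fun _ => ratioVariance X Y μ) :=
    tendstoInMeasure_of_tendsto_ae
      (fun N => ((aemeasurable_ratioSigmaHat (fun i => (hidX i).aemeasurable_fst)
        (fun i => (hidY i).aemeasurable_fst) N).pow_const 2).aestronglyMeasurable)
      (tendsto_ratioSigmaHat_sq_ae hX hY hμY hXs hYs hidX hidY)
  refine ⟨hcons, fun hσ => ?_⟩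
  have hclt := tendstoInDistribution_studentized_ratio hXY hX hY hμY hindep hident hσ
  refine ⟨hclt, fun δ hδ0 hδ1 => ?_⟩
  obtain ⟨z, hz, hzδ⟩ := exists_setIntegral_Ioi_exp_neg_sq_div_two_eq hδ0 hδ1
  refine ⟨z, hz, hzδ, sq_le_two_mul_log_of_setIntegral_Ioi_eq hδ0 hz.le hzδ, ?_⟩
  have h := tendsto_confidence_probability hσ hz (fun N ω => Real.sqrt_nonneg _) hcons
    (fun _ _ => rfl) hclt
  rwa [gaussianReal_zero_one_real_Icc hz.le, hzδ, mul_div_cancel₀ δ two_ne_zero] at h
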